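/- Let $\kappa$ be an infinite cardinal. A group $G$ with $|G|\ge\kappa$ is called $\kappa$-existentially closed if every system of fewer than $\kappa$ equations and inequations with coefficients in $G$ which has a solution in some supergroup $H\ge G$ already has a solution in $G$. Let $G$ be a $\kappa$-existentially closed group and let $\langle X\mid R\rangle$ be any presentation of $G$ by generators and defining relations, that is, $X$ is a set, $R$ is a subset of the free group $F(X)$, and $G$ is isomorphic to the quotient of $F(X)$ by the normal closure of $R$. If the set $R$ of defining relations has cardinality $\mu$, then $\mu\ge\kappa$. -/

import Mathlib

open Cardinal

universe u v

/-- The value at the assignment `a : X → H` of a word `w` in the variables `X` with coefficients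
in `G`, where the coefficients are read in `H` through `f : G →* H`. A word with coefficients in
`G` is an element of the free product of `G` with the free group on `X`. -/
def evalWord {G H X : Type u} [Group G] [Group H] (f : G →* H) (a : X → H)
    (w : Monoid.Coprod G (FreeGroup X)) : H :=
  Monoid.Coprod.lift f (FreeGroup.lift a) w

/-- The assignment `a : X → H` solves, in `H`, the system consisting of the equations `w = 1` for
`w ∈ E` and the inequations `w ≠ 1` for `w ∈ N`. -/
def IsSolution {G H X : Type u} [Group G] [Group H] (f : G →* H)
    (E N : Set (Monoid.Coprod G (FreeGroup X))) (a : X → H) : Prop :=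
  (∀ w ∈ E, evalWord f a w = 1) ∧ ∀ w ∈ N, evalWord f a w ≠ 1

/-- `G` is `κ`-existentially closed: `κ ≤ |G|`, and every system of less than `κ` many equations
and inequations with coefficients in `G` (in any set of variables) which has a solution in some
supergroup of `G` has a solution in `G`. Supergroups are groups `H` with an embedding of `G`. -/
def IsKappaExistentiallyClosed (κ : Cardinal.{u}) (G : Type u) [Group G] : Prop :=
  κ ≤ #G ∧
    ∀ (X : Type u) (E N : Set (Monoid.Coprod G (FreeGroup X))), #E + #N < κ →
      (∃ (H : Type u) (_ : Group H) (f : G →* H), Function.Injective f ∧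
        ∃ a : X → H, IsSolution f E N a) →
      ∃ a : X → G, IsSolution (MonoidHom.id G) E N a

/-! Suppose there are fewer than `κ` relators; each is a finite word, so fewer than `κ` generators
occur in them. If every generator occurs, `G` has a generating set of size less than `κ`, so
`exists_ne_one_commute` gives a nontrivial central element, against `exists_not_commute`. If some
generator occurs in no relator, sending it to 1 and the others to 0 maps `G` onto the integers,
against `hom_int_apply_eq_one`. -/

/-- The set of letters of the reduced word of an element of a free group. -/
def FreeGroup.letters {X : Type*} (r : FreeGroup X) : Set X :=
  open Classical in {x | ∃ b, (x, b) ∈ r.toWord}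

theorem FreeGroup.finite_letters {X : Type*} (r : FreeGroup X) : r.letters.Finite := by
  classical
  refine (r.toWord.map Prod.fst).toFinset.finite_toSet.subset ?_
  rintro x ⟨b, hb⟩
  simp only [List.coe_toFinset, List.mem_map, Set.mem_ofPred_eq]
  exact ⟨(x, b), by convert hb, rfl⟩

theorem FreeGroup.lift_eq_one_of_letters {X H : Type*} [Group H] (a : X → H) (r : FreeGroup X)
    (h : ∀ x ∈ r.letters, a x = 1) : FreeGroup.lift a r = 1 := by
  classical
  rw [← FreeGroup.mk_toWord (x := r), FreeGroup.lift_mk]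
  refine List.prod_eq_one fun y hy => ?_
  obtain ⟨⟨x, b⟩, hx, rfl⟩ := List.mem_map.1 hy
  have : a x = 1 := h x ⟨b, by convert hx⟩
  cases b <;> simp [this]

/-- A set of fewer than `κ` words uses fewer than `κ` letters. -/
theorem FreeGroup.lift_mk_biUnion_letters_lt {X : Type v} (R : Set (FreeGroup X))
    {κ : Cardinal.{u}} (hκ : ℵ₀ ≤ κ) (hR : Cardinal.lift.{u} #R < Cardinal.lift.{v} κ) :
    Cardinal.lift.{u} #(⋃ r ∈ R, r.letters : Set X) < Cardinal.lift.{v} κ := by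
  -- The bound `#R * ℵ₀ = #R` needs `R` infinite; for finite `R` the union is finite.
  rcases lt_or_ge #R ℵ₀ with h | h
  · have hfin : (⋃ r ∈ R, r.letters : Set X).Finite :=
      (Cardinal.lt_aleph0_iff_set_finite.1 h).biUnion fun r _ => r.finite_letters
    calc Cardinal.lift.{u} #(⋃ r ∈ R, r.letters : Set X) < ℵ₀ :=
          Cardinal.lift_lt_aleph0.2 (Cardinal.lt_aleph0_iff_set_finite.2 hfin)
      _ ≤ Cardinal.lift.{v} κ := Cardinal.aleph0_le_lift.2 hκ
  · refine lt_of_le_of_lt (Cardinal.lift_le.2 ?_) hR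
    refine (Cardinal.mk_biUnion_le _ _).trans ?_
    refine (mul_le_mul_right (ciSup_le' fun r =>
      (Cardinal.lt_aleph0_iff_set_finite.2 r.1.finite_letters).le) _).trans ?_
    rw [Cardinal.mul_aleph0_eq h]

/-- An element of infinite order is conjugate to its square in some supergroup. -/
theorem exists_supergroup_conj_sq {G : Type u} [Group G] {g : G}
    (hg : Function.Injective fun n : ℤ => g ^ n) :
    ∃ (H : Type u) (_ : Group H) (f : G →* H), Function.Injective f ∧
      ∃ t : H, t * f g * t⁻¹ = f (g ^ 2) := by
  have h1 : Function.Injective (zpowersHom G g) := fun a b h => hg h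
  have h2 : Function.Injective (zpowersHom G (g ^ 2)) := by
    intro a b h
    simp only [zpowersHom_apply, ← zpow_natCast, ← zpow_mul] at h
    have := hg h
    apply Multiplicative.toAdd.injective
    push_cast at this
    omega
  -- Both subgroups are infinite cyclic, so they can be associated in an HNN extension, whose stable
  -- letter conjugates `g` to `g ^ 2`.
  let φ : (zpowersHom G g).range ≃* (zpowersHom G (g ^ 2)).range :=
    (MonoidHom.ofInjective h1).symm.trans (MonoidHom.ofInjective h2)
  refine ⟨HNNExtension G _ _ φ, inferInstance, HNNExtension.of, HNNExtension.of_injective φ,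
    HNNExtension.t, ?_⟩
  have hφ : φ (MonoidHom.ofInjective h1 (Multiplicative.ofAdd 1)) =
      MonoidHom.ofInjective h2 (Multiplicative.ofAdd 1) := by simp [φ]
  have := HNNExtension.equiv_eq_conj (φ := φ) (MonoidHom.ofInjective h1 (Multiplicative.ofAdd 1))
  rw [hφ] at this
  have hcoe : ∀ (x : G) (h : Function.Injective (zpowersHom G x)),
      (MonoidHom.ofInjective h (Multiplicative.ofAdd 1) : G) = x := fun x h => zpow_one x
  rw [hcoe, hcoe] at this
  exact this.symm

/-- In an infinite group, a nontrivial element is noncentral in some supergroup. -/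
theorem exists_supergroup_not_commute {G : Type u} [Group G] [Infinite G] {c : G} (hc : c ≠ 1) :
    ∃ (H : Type u) (_ : Group H) (f : G →* H), Function.Injective f ∧
      ∃ y : H, y * f c ≠ f c * y := by
  classical
  -- In the Cayley embedding the transposition of `1` and `a` fixes `c`. If it commuted with
  -- translation by `c`, evaluating at `1` would give `c = c * a`.
  obtain ⟨a, ha⟩ := Infinite.exists_notMem_finset ({1, c} : Finset G)
  simp only [Finset.mem_insert, Finset.mem_singleton, not_or] at ha
  refine ⟨Equiv.Perm G, inferInstance, MulAction.toPermHom G G, MulAction.toPerm_injective,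
    Equiv.swap 1 a, fun h => ha.1 ?_⟩
  have := congrArg (fun p : Equiv.Perm G => p 1) h
  simpa [Equiv.swap_apply_of_ne_of_ne hc (Ne.symm ha.2)] using this

namespace IsKappaExistentiallyClosed

variable {κ : Cardinal.{u}} {G : Type u} [Group G]

theorem infinite (hκ : ℵ₀ ≤ κ) (hG : IsKappaExistentiallyClosed κ G) : Infinite G :=
  Cardinal.infinite_iff.2 (hκ.trans hG.1)

theorem exists_conj_sq (hκ : ℵ₀ ≤ κ) (hG : IsKappaExistentiallyClosed κ G) {g : G}
    (hg : Function.Injective fun n : ℤ => g ^ n) : ∃ t : G, t * g * t⁻¹ = g ^ 2 := by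
  let t : Monoid.Coprod G (FreeGroup PUnit.{u + 1}) := Monoid.Coprod.inr (FreeGroup.of ⟨⟩)
  let i : G →* Monoid.Coprod G (FreeGroup PUnit.{u + 1}) := Monoid.Coprod.inl
  obtain ⟨a, ha, -⟩ := hG.2 PUnit {t * i g * t⁻¹ * (i (g ^ 2))⁻¹} ∅
    (lt_of_lt_of_le (by simp) hκ) (by
      obtain ⟨H, _, f, hf, s, hs⟩ := exists_supergroup_conj_sq hg
      refine ⟨H, _, f, hf, fun _ => s, ?_, by simp⟩
      simpa [evalWord, t, i, mul_inv_eq_one] using hs)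
  refine ⟨a ⟨⟩, ?_⟩
  simpa [evalWord, t, i, mul_inv_eq_one] using ha

theorem exists_not_commute (hκ : ℵ₀ ≤ κ) (hG : IsKappaExistentiallyClosed κ G) {c : G}
    (hc : c ≠ 1) : ∃ y : G, y * c ≠ c * y := by
  have := hG.infinite hκ
  let t : Monoid.Coprod G (FreeGroup PUnit.{u + 1}) := Monoid.Coprod.inr (FreeGroup.of ⟨⟩)
  let i : G →* Monoid.Coprod G (FreeGroup PUnit.{u + 1}) := Monoid.Coprod.inl
  obtain ⟨a, -, ha⟩ := hG.2 PUnit ∅ {t * i c * (i c * t)⁻¹}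
    (lt_of_lt_of_le (by simp) hκ) (by
      obtain ⟨H, _, f, hf, s, hs⟩ := exists_supergroup_not_commute hc
      refine ⟨H, _, f, hf, fun _ => s, by simp, ?_⟩
      rintro w rfl h
      refine hs (mul_inv_eq_one.1 ?_)
      simpa only [evalWord, t, i, map_mul, map_inv, Monoid.Coprod.lift_apply_inl,
        Monoid.Coprod.lift_apply_inr, FreeGroup.lift_apply_of] using h)
  refine ⟨a ⟨⟩, fun h => ha _ rfl ?_⟩
  simp only [evalWord, t, i, map_mul, map_inv, Monoid.Coprod.lift_apply_inl,
    Monoid.Coprod.lift_apply_inr, FreeGroup.lift_apply_of]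
  exact mul_inv_eq_one.2 h

/-- Fewer than `κ` elements have a nontrivial common centralizing element. -/
theorem exists_ne_one_commute (hκ : ℵ₀ ≤ κ) (hG : IsKappaExistentiallyClosed κ G) (S : Set G)
    (hS : #S < κ) : ∃ c : G, c ≠ 1 ∧ ∀ s ∈ S, c * s = s * c := by
  let t : Monoid.Coprod G (FreeGroup PUnit.{u + 1}) := Monoid.Coprod.inr (FreeGroup.of ⟨⟩)
  let i : G →* Monoid.Coprod G (FreeGroup PUnit.{u + 1}) := Monoid.Coprod.inl
  have hcard : #((fun s => t * i s * (i s * t)⁻¹) '' S) + #({t} : Set _) < κ :=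
    Cardinal.add_lt_of_lt hκ (Cardinal.mk_image_le.trans_lt hS)
      (lt_of_lt_of_le (by simp) hκ)
  obtain ⟨a, haE, haN⟩ := hG.2 PUnit _ _ hcard (by
    have := hG.infinite hκ
    obtain ⟨g, hg⟩ := exists_ne (1 : G)
    -- The second factor centralizes the embedded copy of `G`.
    refine ⟨G × G, inferInstance, MonoidHom.inl G G, fun _ _ h => congrArg Prod.fst h,
      fun _ => (1, g), ?_, ?_⟩
    · rintro _ ⟨s, -, rfl⟩
      simp [evalWord, t, i]
    · rintro _ rfl
      simpa [evalWord, t] using hg)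
  refine ⟨a ⟨⟩, by simpa [evalWord, t] using haN, fun s hs => mul_inv_eq_one.1 ?_⟩
  simpa only [evalWord, t, i, map_mul, map_inv, Monoid.Coprod.lift_apply_inl,
    Monoid.Coprod.lift_apply_inr, FreeGroup.lift_apply_of, MonoidHom.id_apply] using
      haE _ ⟨s, hs, rfl⟩

/-- Every homomorphism to the integers kills every element. -/
theorem hom_int_apply_eq_one (hκ : ℵ₀ ≤ κ) (hG : IsKappaExistentiallyClosed κ G)
    (φ : G →* Multiplicative ℤ) (g : G) : φ g = 1 := by
  by_contra hne
  have hg : Function.Injective fun n : ℤ => g ^ n := by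
    intro m n h
    have h' := congrArg (fun x => Multiplicative.toAdd (φ x)) h
    simp only [map_zpow, toAdd_zpow, smul_eq_mul] at h'
    exact mul_right_cancel₀ (fun h0 => hne (Multiplicative.toAdd.injective h0)) h'
  obtain ⟨t, ht⟩ := hG.exists_conj_sq hκ hg
  have h' := congrArg φ ht
  -- The target is abelian, so conjugation disappears and `φ g` equals its own square.
  rw [map_mul, map_mul, map_inv, mul_inv_cancel_comm, map_pow, sq] at h'
  exact hne (left_eq_mul.1 h')

end IsKappaExistentiallyClosed

theorem proposition1p7 (κ : Cardinal.{u}) (hκ : ℵ₀ ≤ κ) (G : Type u) [Group G]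
    (hG : IsKappaExistentiallyClosed κ G)
    (X : Type v) (R : Set (FreeGroup X)) (e : G ≃* PresentedGroup R)
    (μ : Cardinal.{v}) (hμ : #R = μ) :
    Cardinal.lift.{v} κ ≤ Cardinal.lift.{u} μ := by
  classical
  subst hμ
  by_contra! hlt
  have hletters := FreeGroup.lift_mk_biUnion_letters_lt R hκ hlt
  by_cases hall : (⋃ r ∈ R, r.letters : Set X) = Set.univ
  · rw [hall, Cardinal.mk_univ] at hletters
    let g : X → G := fun x => e.symm (PresentedGroup.of x)
    have hS : #(Set.range g) < κ := by
      rw [← Cardinal.lift_lt.{u, v}]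
      exact Cardinal.mk_range_le_lift.trans_lt hletters
    obtain ⟨c, hc, hcomm⟩ := hG.exists_ne_one_commute hκ _ hS
    obtain ⟨y, hy⟩ := hG.exists_not_commute hκ hc
    -- Conjugation by `c` fixes every generator, hence all of `G`.
    have hconj : (MulAut.conj c).toMonoidHom.comp e.symm.toMonoidHom = e.symm.toMonoidHom :=
      PresentedGroup.ext fun x => mul_inv_eq_of_eq_mul (hcomm _ ⟨x, rfl⟩)
    have := DFunLike.congr_fun hconj (e y)
    simp only [MonoidHom.comp_apply, MulEquiv.coe_toMonoidHom, MulEquiv.symm_apply_apply,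
      MulAut.conj_apply] at this
    exact hy (mul_inv_eq_iff_eq_mul.1 this).symm
  · obtain ⟨x, hx⟩ := (Set.ne_univ_iff_exists_notMem _).1 hall
    let a : X → Multiplicative ℤ := Pi.mulSingle x (Multiplicative.ofAdd 1)
    have ha : ∀ r ∈ R, FreeGroup.lift a r = 1 := fun r hr =>
      FreeGroup.lift_eq_one_of_letters a r fun y hy =>
        Pi.mulSingle_eq_of_ne (by rintro rfl; exact hx (Set.mem_biUnion hr hy)) _
    have := hG.hom_int_apply_eq_one hκ ((PresentedGroup.toGroup ha).comp e.toMonoidHom)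
      (e.symm (PresentedGroup.of x))
    simp [a] at this
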